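/- Every $t\in(0,1]$ has a unique dyadic expansion $t=\sum_{n\ge 0} t_n 2^{-(n+1)}$, $t_n\in\{0,1\}$, that does not end in zeros; for $t=0$ put $t_n=0$ for all $n$. The baker's transformation $B=(B_1,B_2)$ of $[0,1]^2$ moves the first digit of the first component to the front of the second one: $$B(\xi,x)=\Big(\sum_{n\ge 0}\xi_{n+1}2^{-(n+1)},\ \frac{\xi_0+x}{2}\Big)=\Big(2\xi-\xi_0,\ \frac{\xi_0+x}{2}\Big).$$ Let $B^n=(B^n_1,B^n_2)$ be its $n$-th iterate, and for $0<\kappa<1$ and $\xi,x\in[0,1]$ let $$S(\xi,x)=2\pi\sum_{n=1}^\infty \kappa^n\sin\big(2\pi B_2^n(\xi,x)\big).$$ **Proposition.** There exists $\kappa_0\in[0.55,0.56]$ such that for every $\kappa$ with $0<\kappa\le\kappa_0$ the following holds. For every $\xi\in[0,1]$ the function $S(\xi,\cdot)$ is differentiable on $[0,1]$ (one-sidedly at the endpoints), with derivative denoted by $S'(\xi,\cdot)$, and the vectors $$V_{\xi,\eta}(x)=\big(S(\xi,x)-S(\eta,x),\ S'(\xi,x)-S'(\eta,x)\big)\in\mathbb{R}^2$$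 satisfy $\inf_{x\in[0,1]}|V_{\xi,\eta}(x)|>0$ uniformly on $\{|\xi-\eta|>\frac12\}$: there is a constant $c>0$ such that $\inf_{x\in[0,1]}|V_{\xi,\eta}(x)|\ge c$ for all $\xi,\eta\in[0,1]$ with $|\xi-\eta|>\frac12$. Here $|\cdot|$ is the Euclidean norm. -/

import Mathlib

open Set Filter Topology

noncomputable section

namespace Weierstrass

/-- The `n`-th digit (`n = 0, 1, …`, with weight `2⁻⁽ⁿ⁺¹⁾`) of the dyadic expansion of `t ∈ [0,1]`.
A dyadic rational `t ≠ 0` gets the expansion that does not end in zeros; `0` gets the zero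
sequence. See `hasSum_digit` and `exists_digit_eq_one`. -/
def digit (t : ℝ) (n : ℕ) : Fin 2 :=
  if 0 < t ∧ Even ⌈(2 : ℝ) ^ (n + 1) * t⌉ then 1 else 0

theorem sum_digit {t : ℝ} (h0 : 0 < t) (h1 : t ≤ 1) (N : ℕ) :
    ∑ n ∈ Finset.range N, ((digit t n : ℕ) : ℝ) / 2 ^ (n + 1)
      = ((⌈(2 : ℝ) ^ N * t⌉ : ℝ) - 1) / 2 ^ N := by
  induction N with
  | zero =>
    have : ⌈t⌉ = 1 := by
      rw [Int.ceil_eq_iff]; constructor <;> push_cast <;> linarith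
    simp [this]
  | succ N ih =>
    rw [Finset.sum_range_succ, ih]
    set m := ⌈(2 : ℝ) ^ (N + 1) * t⌉ with hm
    have hm' := (Int.ceil_eq_iff (a := (2 : ℝ) ^ (N + 1) * t) (z := m)).1 hm.symm
    rw [pow_succ] at hm'
    have hp : (0 : ℝ) < 2 ^ N := by positivity
    rcases Int.even_or_odd m with he | ho
    · have hd : digit t N = 1 := by simp [digit, h0, ← hm, he]
      obtain ⟨k, hk⟩ := he
      have hk' : (m : ℝ) = k + k := by exact_mod_cast hk
      have hc : ⌈(2 : ℝ) ^ N * t⌉ = k := by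
        rw [Int.ceil_eq_iff]; constructor <;> nlinarith [hm'.1, hm'.2]
      rw [hd, hc, hk', pow_succ]
      field_simp
      norm_num
      ring
    · have hd : digit t N = 0 := by
        have : ¬ Even m := by simpa using ho
        simp [digit, ← hm, this]
      obtain ⟨k, hk⟩ := ho
      have hk' : (m : ℝ) = 2 * k + 1 := by exact_mod_cast hk
      have hc : ⌈(2 : ℝ) ^ N * t⌉ = k + 1 := by
        rw [Int.ceil_eq_iff]; constructor <;> push_cast <;> nlinarith [hm'.1, hm'.2]
      rw [hd, hc, hk', pow_succ]
      push_cast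
      field_simp
      norm_num

theorem digit_zero_left (n : ℕ) : digit 0 n = 0 := by simp [digit]

/-- The digits of `t ∈ [0,1]` represent `t`. -/
theorem hasSum_digit {t : ℝ} (ht : t ∈ Icc (0 : ℝ) 1) :
    HasSum (fun n : ℕ => ((digit t n : ℕ) : ℝ) / 2 ^ (n + 1)) t := by
  rcases ht.1.eq_or_lt with h | h0
  · subst h; simp [digit_zero_left]
  rw [hasSum_iff_tendsto_nat_of_nonneg (fun n => by positivity)]
  simp_rw [sum_digit h0 ht.2]
  have hlim : Tendsto (fun N : ℕ => t - (1 / 2 : ℝ) ^ N) atTop (𝓝 t) := by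
    simpa using (tendsto_pow_atTop_nhds_zero_of_lt_one (r := (1 / 2 : ℝ))
      (by norm_num) (by norm_num)).const_sub t
  refine tendsto_of_tendsto_of_tendsto_of_le_of_le hlim tendsto_const_nhds ?_ ?_
  · intro N
    have hp : (0 : ℝ) < 2 ^ N := by positivity
    have := Int.le_ceil ((2 : ℝ) ^ N * t)
    show t - (1 / 2 : ℝ) ^ N ≤ _
    rw [le_div_iff₀ hp, sub_mul, ← mul_pow]
    norm_num
    linarith
  · intro N
    have hp : (0 : ℝ) < 2 ^ N := by positivity
    have := Int.ceil_lt_add_one ((2 : ℝ) ^ N * t)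
    show _ ≤ t
    rw [div_le_iff₀ hp]
    linarith

/-- The expansion chosen for `t ∈ (0,1]` does not end in zeros. -/
theorem exists_digit_eq_one {t : ℝ} (ht : t ∈ Ioc (0 : ℝ) 1) (N : ℕ) :
    ∃ n ≥ N, digit t n = 1 := by
  by_contra! h
  have hz : ∀ n ≥ N, digit t n = 0 := fun n hn => by
    have := h n hn
    omega
  have h1 : HasSum (fun n : ℕ => ((digit t n : ℕ) : ℝ) / 2 ^ (n + 1))
      (∑ n ∈ Finset.range N, ((digit t n : ℕ) : ℝ) / 2 ^ (n + 1)) :=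
    hasSum_sum_of_ne_finset_zero fun n hn => by
      have : N ≤ n := by simpa using hn
      simp [hz n this]
  have h2 := h1.unique (hasSum_digit ⟨ht.1.le, ht.2⟩)
  rw [sum_digit ht.1 ht.2] at h2
  have hp : (0 : ℝ) < 2 ^ N := by positivity
  have := Int.ceil_lt_add_one ((2 : ℝ) ^ N * t)
  rw [div_eq_iff hp.ne'] at h2
  linarith

/-- The map sending a two-sided sequence of digits `ω` to the pair
`(∑_{n ≥ 0} ω₋ₙ 2⁻⁽ⁿ⁺¹⁾, ∑_{n ≥ 1} ωₙ 2⁻ⁿ)`. -/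
def T (ω : ℤ → Fin 2) : ℝ × ℝ :=
  (∑' n : ℕ, ((ω (-(n : ℤ)) : ℕ) : ℝ) / 2 ^ (n + 1),
   ∑' n : ℕ, ((ω ((n : ℤ) + 1) : ℕ) : ℝ) / 2 ^ (n + 1))

/-- The inverse of `T`: the digits of `ξ` stand at the places `0, -1, -2, …`,
those of `x` at the places `1, 2, …`. -/
def Tinv (p : ℝ × ℝ) (k : ℤ) : Fin 2 :=
  if k ≤ 0 then digit p.1 (-k).toNat else digit p.2 (k - 1).toNat

/-- The shift that carries the digit at place `0` (the first digit of `ξ`) to place `1`. -/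
def shift (ω : ℤ → Fin 2) (k : ℤ) : Fin 2 := ω (k - 1)

/-- The baker's transformation of the unit square. -/
def baker (p : ℝ × ℝ) : ℝ × ℝ := T (shift (Tinv p))

theorem Tinv_neg (p : ℝ × ℝ) (n : ℕ) : Tinv p (-(n : ℤ)) = digit p.1 n := by
  simp [Tinv]

theorem Tinv_pos (p : ℝ × ℝ) (n : ℕ) : Tinv p ((n : ℤ) + 1) = digit p.2 n := by
  have : ¬ ((n : ℤ) + 1 ≤ 0) := by omega
  simp [Tinv, this]

theorem T_Tinv {p : ℝ × ℝ} (h₁ : p.1 ∈ Icc (0 : ℝ) 1) (h₂ : p.2 ∈ Icc (0 : ℝ) 1) :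
    T (Tinv p) = p := by
  simp only [T, Tinv_neg, Tinv_pos, (hasSum_digit h₁).tsum_eq, (hasSum_digit h₂).tsum_eq]

theorem digit_zero {t : ℝ} (ht : t ∈ Icc (0 : ℝ) 1) :
    digit t 0 = if 1 / 2 < t then 1 else 0 := by
  rcases ht.1.eq_or_lt with h | h0
  · subst h; norm_num [digit]
  split_ifs with h
  · have : ⌈(2 : ℝ) ^ (0 + 1) * t⌉ = 2 := by
      rw [Int.ceil_eq_iff]; constructor <;> norm_num <;> linarith [ht.2]
    simp only [digit, this]
    simp [h0]
  · have : ⌈(2 : ℝ) ^ (0 + 1) * t⌉ = 1 := by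
      rw [Int.ceil_eq_iff]; constructor <;> norm_num <;> linarith
    simp only [digit, this]
    simp

/-- The action of the baker's transformation on the unit square. -/
theorem baker_eq {ξ x : ℝ} (hξ : ξ ∈ Icc (0 : ℝ) 1) (hx : x ∈ Icc (0 : ℝ) 1) :
    baker (ξ, x) = if 1 / 2 < ξ then (2 * ξ - 1, (x + 1) / 2) else (2 * ξ, x / 2) := by
  have e1 : ∀ n : ℕ, shift (Tinv (ξ, x)) (-(n : ℤ)) = digit ξ (n + 1) := fun n => by
    have := Tinv_neg (ξ, x) (n + 1)
    rw [shift, ← this]; congr 1; push_cast; ring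
  have e2 : ∀ n : ℕ, shift (Tinv (ξ, x)) (((n + 1 : ℕ) : ℤ) + 1) = digit x n := fun n => by
    have := Tinv_pos (ξ, x) n
    rw [shift, ← this]; congr 1; push_cast; ring
  have e3 : shift (Tinv (ξ, x)) (((0 : ℕ) : ℤ) + 1) = digit ξ 0 := by
    simp [shift, Tinv]
  have s1 : HasSum (fun n : ℕ => ((shift (Tinv (ξ, x)) (-(n : ℤ)) : ℕ) : ℝ) / 2 ^ (n + 1))
      (2 * ξ - (digit ξ 0 : ℕ)) := by
    have h := ((hasSum_nat_add_iff' 1).2 (hasSum_digit hξ)).mul_left 2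
    have hf : (fun n : ℕ => ((shift (Tinv (ξ, x)) (-(n : ℤ)) : ℕ) : ℝ) / 2 ^ (n + 1))
        = fun n : ℕ => 2 * (((digit ξ (n + 1) : ℕ) : ℝ) / 2 ^ (n + 1 + 1)) := by
      funext n; rw [e1, pow_succ _ (n + 1)]; field_simp
    have hv : 2 * ξ - ((digit ξ 0 : ℕ) : ℝ)
        = 2 * (ξ - ∑ n ∈ Finset.range 1, ((digit ξ n : ℕ) : ℝ) / 2 ^ (n + 1)) := by
      simp only [Finset.sum_range_one]; ring
    rw [hf, hv]; exact h
  have s2 : HasSum (fun n : ℕ => ((shift (Tinv (ξ, x)) ((n : ℤ) + 1) : ℕ) : ℝ) / 2 ^ (n + 1))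
      ((x + (digit ξ 0 : ℕ)) / 2) := by
    rw [← hasSum_nat_add_iff' 1]
    have hf : (fun n : ℕ => ((shift (Tinv (ξ, x)) (((n + 1 : ℕ) : ℤ) + 1) : ℕ) : ℝ)
          / 2 ^ (n + 1 + 1)) = fun n : ℕ => 1 / 2 * (((digit x n : ℕ) : ℝ) / 2 ^ (n + 1)) := by
      funext n; rw [e2, pow_succ _ (n + 1)]; field_simp
    have hv : (x + ((digit ξ 0 : ℕ) : ℝ)) / 2 - ∑ n ∈ Finset.range 1,
          ((shift (Tinv (ξ, x)) ((n : ℤ) + 1) : ℕ) : ℝ) / 2 ^ (n + 1) = 1 / 2 * x := by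
      simp only [Finset.sum_range_one, e3]; ring
    rw [hf, hv]; exact (hasSum_digit hx).mul_left (1 / 2)
  rw [baker, T, s1.tsum_eq, s2.tsum_eq, digit_zero hξ]
  split_ifs <;> simp

/-- `S(ξ, x) = 2π ∑_{n ≥ 1} κⁿ sin(2π B₂ⁿ(ξ, x))`, where `B` is the baker's transformation. -/
def S (κ ξ x : ℝ) : ℝ :=
  2 * Real.pi * ∑' n : ℕ, κ ^ (n + 1) * Real.sin (2 * Real.pi * (baker^[n + 1] (ξ, x)).2)

theorem summable_S {κ : ℝ} (h0 : 0 < κ) (h1 : κ < 1) (ξ x : ℝ) :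
    Summable fun n : ℕ =>
      κ ^ (n + 1) * Real.sin (2 * Real.pi * (baker^[n + 1] (ξ, x)).2) := by
  refine Summable.of_norm_bounded
    ((summable_nat_add_iff 1).2 (summable_geometric_of_lt_one h0.le h1)) fun n => ?_
  rw [norm_mul, Real.norm_of_nonneg (by positivity : 0 ≤ κ ^ (n + 1))]
  exact mul_le_of_le_one_right (by positivity) (Real.abs_sin_le_one _)

/-- The derivative `S'(ξ, ·)` with respect to `x ∈ [0,1]` (one-sided at the endpoints). -/
def S' (κ ξ x : ℝ) : ℝ := derivWithin (S κ ξ) (Icc 0 1) x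

/-- The vector `V(x) = (S(ξ,x) - S(η,x), S'(ξ,x) - S'(η,x))`, in the Euclidean plane. -/
def V (κ ξ η x : ℝ) : EuclideanSpace ℝ (Fin 2) :=
  !₂[S κ ξ x - S κ η x, S' κ ξ x - S' κ η x]

end Weierstrass

end

/-!
The second component of `Bⁿ(ξ, x)` is affine in `x` with slope `2⁻ⁿ` and depends on `ξ` only through
its first `n` digits, so `S` and `S'` are sine and cosine series with coefficients of size `κⁿ` and
`(κ/2)ⁿ`. If `ξ` and `η` differ in the first digit, the leading terms of `S(ξ, x) - S(η, x)` and
`S'(ξ, x) - S'(η, x)` are multiples of the coordinates of the unit vector `(sin πx, cos πx)`, so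
`V_{ξ,η}(x)` can be short only if the remaining terms, on the same scale, form a vector of length
almost one. Bounding the second terms separately and the tails by geometric series excludes this for
`κ ≤ 0.55`. The second sine terms are bounded by using that the separation of `ξ` and `η` also
orders their second digits.
-/

namespace Weierstrass

open Real

theorem digit_two_mul_sub_digit (t : ℝ) (n : ℕ) :
    digit (2 * t - (digit t 0 : ℕ)) n = digit t (n + 1) := by
  have pos_iff : 0 < 2 * t - ((digit t 0 : ℕ) : ℝ) ↔ 0 < t := by
    by_cases h : 0 < t ∧ Even ⌈(2 : ℝ) ^ (0 + 1) * t⌉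
    · obtain ⟨k, hk⟩ := h.2
      have ceil_pos : 0 < ⌈(2 : ℝ) ^ (0 + 1) * t⌉ := Int.ceil_pos.2 (mul_pos (by positivity) h.1)
      have one_lt : ((1 : ℤ) : ℝ) < 2 ^ (0 + 1) * t := Int.lt_ceil.1 (by omega)
      norm_num at one_lt
      rw [show digit t 0 = 1 from if_pos h, Fin.val_one, Nat.cast_one]
      constructor <;> intro <;> linarith
    · rw [show digit t 0 = 0 from if_neg h]
      simp
  have ceil_eq : ⌈(2 : ℝ) ^ (n + 1) * (2 * t - ((digit t 0 : ℕ) : ℝ))⌉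
      = ⌈(2 : ℝ) ^ (n + 1 + 1) * t⌉ - 2 ^ (n + 1) * (digit t 0 : ℕ) := by
    rw [← Int.ceil_sub_intCast]
    congr 1
    push_cast
    ring
  have even_iff : Even (⌈(2 : ℝ) ^ (n + 1 + 1) * t⌉ - 2 ^ (n + 1) * ((digit t 0 : ℕ) : ℤ))
      ↔ Even ⌈(2 : ℝ) ^ (n + 1 + 1) * t⌉ := by
    simp [Int.even_sub, parity_simps]
  simp only [digit.eq_1 _ n, digit.eq_1 t (n + 1), ceil_eq, pos_iff, even_iff]

theorem two_mul_sub_digit_mem {t : ℝ} (ht : t ∈ Icc (0 : ℝ) 1) :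
    2 * t - (digit t 0 : ℕ) ∈ Icc (0 : ℝ) 1 := by
  obtain ⟨h0, h1⟩ := ht
  rw [digit_zero ⟨h0, h1⟩]
  split_ifs <;> constructor <;> norm_num <;> linarith

theorem half_digit_add_mem {x : ℝ} (d : Fin 2) (hx : x ∈ Icc (0 : ℝ) 1) :
    ((d : ℕ) + x) / 2 ∈ Icc (0 : ℝ) 1 := by
  have hd : ((d : ℕ) : ℝ) ≤ 1 := by exact_mod_cast Nat.le_of_lt_succ d.isLt
  constructor <;> linarith [hx.1, hx.2, Nat.cast_nonneg (α := ℝ) (d : ℕ)]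

theorem baker_eq_digit {ξ x : ℝ} (hξ : ξ ∈ Icc (0 : ℝ) 1) (hx : x ∈ Icc (0 : ℝ) 1) :
    baker (ξ, x) = (2 * ξ - (digit ξ 0 : ℕ), ((digit ξ 0 : ℕ) + x) / 2) := by
  rw [baker_eq hξ hx, digit_zero hξ]
  split_ifs <;> simp [add_comm]

theorem digit_zero_mono {s t : ℝ} (hs : s ∈ Icc (0 : ℝ) 1) (ht : t ∈ Icc (0 : ℝ) 1) (hst : s ≤ t) :
    digit s 0 ≤ digit t 0 := by
  rw [digit_zero hs, digit_zero ht]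
  split_ifs <;> first | decide | linarith

/-- The first digit of `η` is smaller than that of `ξ`, and the second one is not larger. This is
what the estimates retain of the separation `1 / 2 < ξ - η`. -/
def LeadingDigitsLT (η ξ : ℝ) : Prop :=
  digit η 0 < digit ξ 0 ∧ digit η 1 ≤ digit ξ 1

theorem LeadingDigitsLT.digit_zero_eq {ξ η : ℝ} (h : LeadingDigitsLT η ξ) :
    digit ξ 0 = 1 ∧ digit η 0 = 0 := by
  have := h.1
  omega

theorem leadingDigitsLT_of_half_lt_sub {ξ η : ℝ} (hξ : ξ ∈ Icc (0 : ℝ) 1)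
    (hη : η ∈ Icc (0 : ℝ) 1) (h : 1 / 2 < ξ - η) : LeadingDigitsLT η ξ := by
  have hdξ : digit ξ 0 = 1 := by rw [digit_zero hξ, if_pos (by linarith [hη.1])]
  have hdη : digit η 0 = 0 := by rw [digit_zero hη, if_neg (by linarith [hξ.2])]
  refine ⟨by simp [hdξ, hdη], ?_⟩
  rw [← digit_two_mul_sub_digit ξ, ← digit_two_mul_sub_digit η]
  refine digit_zero_mono (two_mul_sub_digit_mem hη) (two_mul_sub_digit_mem hξ) ?_
  rw [hdξ, hdη, Fin.val_one, Fin.val_zero, Nat.cast_one, Nat.cast_zero]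
  linarith

theorem leadingDigitsLT_or_leadingDigitsLT {ξ η : ℝ} (hξ : ξ ∈ Icc (0 : ℝ) 1)
    (hη : η ∈ Icc (0 : ℝ) 1) (h : 1 / 2 < |ξ - η|) : LeadingDigitsLT η ξ ∨ LeadingDigitsLT ξ η :=
  (lt_abs.1 h).imp (leadingDigitsLT_of_half_lt_sub hξ hη)
    fun h => leadingDigitsLT_of_half_lt_sub hη hξ (by rwa [← neg_sub])

/-- The inverse branch of the `n`-fold doubling map that puts the digits `ξₙ₋₁ … ξ₀` in front of the
digits of `x`; by `snd_iterate_baker` it is `x ↦ B₂ⁿ(ξ, x)`, extended to an affine map of `ℝ`. -/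
noncomputable def invBranch (ξ : ℝ) : ℕ → ℝ → ℝ
  | 0, x => x
  | n + 1, x => ((digit ξ n : ℕ) + invBranch ξ n x) / 2

theorem invBranch_succ' (ξ x : ℝ) (n : ℕ) :
    invBranch (2 * ξ - (digit ξ 0 : ℕ)) n (((digit ξ 0 : ℕ) + x) / 2) = invBranch ξ (n + 1) x := by
  induction n with
  | zero => rfl
  | succ n ih => rw [invBranch, ih, digit_two_mul_sub_digit, ← invBranch]

theorem snd_iterate_baker {ξ x : ℝ} (hξ : ξ ∈ Icc (0 : ℝ) 1) (hx : x ∈ Icc (0 : ℝ) 1) (n : ℕ) :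
    (baker^[n] (ξ, x)).2 = invBranch ξ n x := by
  induction n generalizing ξ x with
  | zero => rfl
  | succ n ih =>
    rw [Function.iterate_succ_apply, baker_eq_digit hξ hx,
      ih (two_mul_sub_digit_mem hξ) (half_digit_add_mem _ hx), invBranch_succ']

theorem hasDerivAt_invBranch (ξ : ℝ) (n : ℕ) (x : ℝ) :
    HasDerivAt (invBranch ξ n) (1 / 2 ^ n) x := by
  induction n with
  | zero => exact (hasDerivAt_id x).congr_deriv (by norm_num)
  | succ n ih =>
    refine ((ih.const_add _).div_const 2).congr_deriv ?_
    rw [pow_succ, div_div]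

theorem two_pi_mul_invBranch_one (ξ x : ℝ) :
    2 * π * invBranch ξ 1 x = π * x + (digit ξ 0 : ℕ) * π := by
  simp only [invBranch]
  ring

theorem two_pi_mul_invBranch_two (ξ x : ℝ) :
    2 * π * invBranch ξ 2 x
      = π * x / 2 + (digit ξ 0 : ℕ) * (π / 2) + (digit ξ 1 : ℕ) * π := by
  simp only [invBranch]
  ring

theorem abs_pow_mul_le {r y : ℝ} (hy : |y| ≤ 1) (n : ℕ) : |r ^ n * y| ≤ |r| ^ n := by
  rw [abs_mul, abs_pow]
  exact mul_le_of_le_one_right (by positivity) hy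

theorem summable_pow_succ_mul {r : ℝ} (hr : |r| < 1) {g : ℕ → ℝ} (hg : ∀ n, |g n| ≤ 1) :
    Summable fun n : ℕ => r ^ (n + 1) * g n :=
  .of_norm_bounded ((summable_nat_add_iff 1).2 (summable_geometric_of_lt_one (abs_nonneg r) hr))
    fun n => abs_pow_mul_le (hg n) (n + 1)

section Series

variable {κ ξ x : ℝ}

theorem abs_half_lt_one (hκ : |κ| < 1) : |κ / 2| < 1 := by
  rw [abs_div, abs_two]
  linarith [abs_nonneg κ]

theorem hasSum_S (hκ : |κ| < 1) (hξ : ξ ∈ Icc (0 : ℝ) 1) (hx : x ∈ Icc (0 : ℝ) 1) :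
    HasSum (fun n : ℕ => κ ^ (n + 1) * sin (2 * π * invBranch ξ (n + 1) x))
      (S κ ξ x / (2 * π)) := by
  have hsum := summable_pow_succ_mul hκ fun n => abs_sin_le_one (2 * π * invBranch ξ (n + 1) x)
  convert! hsum.hasSum
  rw [S, mul_div_cancel_left₀ _ two_pi_pos.ne']
  simp only [snd_iterate_baker hξ hx]

theorem hasDerivAt_tsum_sin (hκ : |κ| < 1) (ξ x : ℝ) :
    HasDerivAt (fun y => ∑' n : ℕ, κ ^ (n + 1) * sin (2 * π * invBranch ξ (n + 1) y))
      (2 * π * ∑' n : ℕ, (κ / 2) ^ (n + 1) * cos (2 * π * invBranch ξ (n + 1) x)) x := by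
  have hsum := summable_pow_succ_mul hκ fun n => abs_sin_le_one (2 * π * invBranch ξ (n + 1) x)
  have hbound : Summable fun n : ℕ => 2 * π * |κ / 2| ^ (n + 1) :=
    ((summable_nat_add_iff 1).2
      (summable_geometric_of_lt_one (abs_nonneg _) (abs_half_lt_one hκ))).mul_left _
  rw [← tsum_mul_left]
  refine hasDerivAt_tsum (g := fun n y => κ ^ (n + 1) * sin (2 * π * invBranch ξ (n + 1) y))
    (g' := fun n y => 2 * π * ((κ / 2) ^ (n + 1) * cos (2 * π * invBranch ξ (n + 1) y)))
    hbound (fun n y => ?_) (fun n y => ?_) hsum x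
  · refine ((((hasDerivAt_invBranch ξ (n + 1) y).const_mul (2 * π)).sin).const_mul _).congr_deriv ?_
    rw [div_pow]
    ring
  · rw [norm_mul, norm_of_nonneg two_pi_pos.le]
    exact mul_le_mul_of_nonneg_left (abs_pow_mul_le (abs_cos_le_one _) _) two_pi_pos.le

theorem hasDerivWithinAt_S (hκ : |κ| < 1) (hξ : ξ ∈ Icc (0 : ℝ) 1) (hx : x ∈ Icc (0 : ℝ) 1) :
    HasDerivWithinAt (S κ ξ)
      (2 * π * (2 * π * ∑' n : ℕ, (κ / 2) ^ (n + 1) * cos (2 * π * invBranch ξ (n + 1) x)))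
      (Icc 0 1) x := by
  have hS : ∀ y ∈ Icc (0 : ℝ) 1,
      S κ ξ y = 2 * π * ∑' n : ℕ, κ ^ (n + 1) * sin (2 * π * invBranch ξ (n + 1) y) := by
    intro y hy
    simp only [S, snd_iterate_baker hξ hy]
  exact ((hasDerivAt_tsum_sin hκ ξ x).const_mul (2 * π)).hasDerivWithinAt.congr hS (hS x hx)

theorem hasSum_S' (hκ : |κ| < 1) (hξ : ξ ∈ Icc (0 : ℝ) 1) (hx : x ∈ Icc (0 : ℝ) 1) :
    HasSum (fun n : ℕ => (κ / 2) ^ (n + 1) * cos (2 * π * invBranch ξ (n + 1) x))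
      (S' κ ξ x / (2 * π) ^ 2) := by
  have hsum := summable_pow_succ_mul (abs_half_lt_one hκ)
    fun n => abs_cos_le_one (2 * π * invBranch ξ (n + 1) x)
  convert! hsum.hasSum
  rw [S', (hasDerivWithinAt_S hκ hξ hx).derivWithin (uniqueDiffOn_Icc one_pos x hx)]
  field_simp

end Series

theorem abs_sub_le_of_hasSum_pow_succ_mul {r C D : ℝ} {g : ℕ → ℝ} (h0 : 0 ≤ r) (h1 : r < 1)
    (hg : ∀ n, |g n| ≤ C) (hD : HasSum (fun n => r ^ (n + 1) * g n) D) :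
    |D - (r * g 0 + r ^ 2 * g 1)| ≤ C * r ^ 3 / (1 - r) := by
  have hterm : ∀ n, ‖r ^ (n + 1) * g n‖ ≤ C * r * r ^ n := fun n => by
    rw [norm_mul, norm_of_nonneg (pow_nonneg h0 _), mul_comm, mul_assoc, ← pow_succ']
    exact mul_le_mul_of_nonneg_right (hg n) (pow_nonneg h0 _)
  calc |D - (r * g 0 + r ^ 2 * g 1)|
      = ‖∑ n ∈ Finset.range 2, r ^ (n + 1) * g n - D‖ := by
        rw [← norm_eq_abs, norm_sub_rev]
        simp [Finset.sum_range_succ]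
    _ ≤ C * r * r ^ 2 / (1 - r) := norm_sub_le_of_geometric_bound_of_hasSum h1 hterm hD 2
    _ = C * r ^ 3 / (1 - r) := by ring

/-- Bound for `sin πx` in terms of `κ` at points where `S(ξ, x) = S(η, x)`: half the contribution
`κ² + 2κ³ / (1 - κ)` of the terms after the first one, divided by `κ`. -/
noncomputable def sinBound (κ : ℝ) : ℝ := κ / 2 + κ ^ 2 / (1 - κ)

/-- Bound for `|cos πx|` in terms of `κ` at points where `S'(ξ, x) = S'(η, x)`: the contribution
`√2 (κ/2)² + 2(κ/2)³ / (1 - κ/2)` of the terms after the first one, divided by `κ`. -/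
noncomputable def cosBound (κ : ℝ) : ℝ := √2 * κ / 4 + κ ^ 2 / (2 * (2 - κ))

/-- Lower bound for `‖V κ ξ η x‖` when the leading digits of `ξ` and `η` are ordered: the amount by
which the vector `(sinBound κ, cosBound κ)` is shorter than the unit vector `(sin πx, |cos πx|)`,
times the factor `4πκ` in front of `sin πx` in `S(ξ, x) - S(η, x)`. It is informative only if
positive, which fails for `κ` close to `1`. -/
noncomputable def normBound (κ : ℝ) : ℝ := 4 * π * κ * (1 - √(sinBound κ ^ 2 + cosBound κ ^ 2))

section LowerBounds

variable {κ ξ η x : ℝ}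

theorem sin_invBranch_two_sub_le_one (hx : x ∈ Icc (0 : ℝ) 1) (h : LeadingDigitsLT η ξ) :
    sin (2 * π * invBranch ξ 2 x) - sin (2 * π * invBranch η 2 x) ≤ 1 := by
  have hlo : 0 ≤ π * x / 2 := by have := hx.1; positivity
  have hhi : π * x / 2 ≤ π / 2 := by nlinarith [hx.2, pi_pos]
  have hs : 0 ≤ sin (π * x / 2) := sin_nonneg_of_nonneg_of_le_pi hlo (by linarith [pi_pos])
  have hc : 0 ≤ cos (π * x / 2) := cos_nonneg_of_neg_pi_div_two_le_of_le (by linarith [pi_pos]) hhi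
  have hs1 := sin_le_one (π * x / 2)
  have hc1 := cos_le_one (π * x / 2)
  obtain ⟨hξ0, hη0⟩ := h.digit_zero_eq
  have hdigits : digit ξ 1 = digit η 1 ∨ digit ξ 1 = 1 ∧ digit η 1 = 0 := by
    have := h.2
    omega
  rw [two_pi_mul_invBranch_two, two_pi_mul_invBranch_two, sin_add_nat_mul_pi, sin_add_nat_mul_pi,
    hξ0, hη0, Fin.val_one, Fin.val_zero, Nat.cast_one, Nat.cast_zero, one_mul, zero_mul, add_zero,
    sin_add_pi_div_two]
  rcases hdigits with heq | ⟨hξ1, hη1⟩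
  · rw [heq]
    rcases neg_one_pow_eq_or ℝ (digit η 1 : ℕ) with hsign | hsign <;> rw [hsign] <;> linarith
  · rw [hξ1, hη1, Fin.val_one, Fin.val_zero, pow_one, pow_zero]
    linarith

theorem abs_cos_invBranch_two_sub_le (x : ℝ) (h : digit ξ 0 = 1 ∧ digit η 0 = 0) :
    |cos (2 * π * invBranch ξ 2 x) - cos (2 * π * invBranch η 2 x)| ≤ √2 := by
  apply abs_le_sqrt
  have hsq := sin_sq_add_cos_sq (π * x / 2)
  have hadd := sq_nonneg (sin (π * x / 2) + cos (π * x / 2))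
  have hsub := sq_nonneg (sin (π * x / 2) - cos (π * x / 2))
  rw [two_pi_mul_invBranch_two, two_pi_mul_invBranch_two, cos_add_nat_mul_pi, cos_add_nat_mul_pi,
    h.1, h.2, Fin.val_one, Fin.val_zero, Nat.cast_one, Nat.cast_zero, one_mul, zero_mul, add_zero,
    cos_add_pi_div_two]
  rcases neg_one_pow_eq_or ℝ (digit ξ 1 : ℕ) with hξ1 | hξ1 <;>
    rcases neg_one_pow_eq_or ℝ (digit η 1 : ℕ) with hη1 | hη1 <;> rw [hξ1, hη1] <;> linarith

theorem sin_sub_sinBound_le (h0 : 0 < κ) (h1 : κ < 1) (hξ : ξ ∈ Icc (0 : ℝ) 1)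
    (hη : η ∈ Icc (0 : ℝ) 1) (hx : x ∈ Icc (0 : ℝ) 1) (h : LeadingDigitsLT η ξ) :
    4 * π * κ * (sin (π * x) - sinBound κ) ≤ |S κ ξ x - S κ η x| := by
  have hκ : |κ| < 1 := by rwa [abs_of_pos h0]
  set g : ℕ → ℝ := fun n =>
    sin (2 * π * invBranch ξ (n + 1) x) - sin (2 * π * invBranch η (n + 1) x) with hg
  set D := (S κ ξ x - S κ η x) / (2 * π) with hD
  have hsum : HasSum (fun n => κ ^ (n + 1) * g n) D := by
    simpa only [hg, mul_sub, hD, sub_div] using (hasSum_S hκ hξ hx).sub (hasSum_S hκ hη hx)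
  have htail : |D - (κ * g 0 + κ ^ 2 * g 1)| ≤ 2 * κ ^ 3 / (1 - κ) :=
    abs_sub_le_of_hasSum_pow_succ_mul h0.le h1 (fun n => (abs_sub _ _).trans
      ((add_le_add (abs_sin_le_one _) (abs_sin_le_one _)).trans_eq one_add_one_eq_two)) hsum
  have hg0 : g 0 = -(2 * sin (π * x)) := by
    simp only [hg, zero_add, two_pi_mul_invBranch_one, h.digit_zero_eq, Fin.val_one, Fin.val_zero,
      Nat.cast_one, Nat.cast_zero, one_mul, zero_mul, add_zero, sin_add_pi]
    ring
  have hg1 : κ ^ 2 * g 1 ≤ κ ^ 2 :=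
    mul_le_of_le_one_right (sq_nonneg κ) (sin_invBranch_two_sub_le_one hx h)
  have hlower : 2 * κ * (sin (π * x) - sinBound κ) ≤ |D| :=
    calc 2 * κ * (sin (π * x) - sinBound κ)
        = -(κ * g 0) - κ ^ 2 - 2 * κ ^ 3 / (1 - κ) := by rw [hg0, sinBound]; ring
      _ ≤ -D := by linarith [(abs_le.1 htail).2]
      _ ≤ |D| := neg_le_abs D
  rw [hD, abs_div, abs_of_pos two_pi_pos, le_div_iff₀ two_pi_pos] at hlower
  linarith

theorem abs_cos_sub_cosBound_le (h0 : 0 < κ) (h1 : κ < 1) (hξ : ξ ∈ Icc (0 : ℝ) 1)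
    (hη : η ∈ Icc (0 : ℝ) 1) (hx : x ∈ Icc (0 : ℝ) 1) (h : digit ξ 0 = 1 ∧ digit η 0 = 0) :
    4 * π ^ 2 * κ * (|cos (π * x)| - cosBound κ) ≤ |S' κ ξ x - S' κ η x| := by
  have hκ : |κ| < 1 := by rwa [abs_of_pos h0]
  set g : ℕ → ℝ := fun n =>
    cos (2 * π * invBranch ξ (n + 1) x) - cos (2 * π * invBranch η (n + 1) x) with hg
  set D := (S' κ ξ x - S' κ η x) / (2 * π) ^ 2 with hD
  have hsum : HasSum (fun n => (κ / 2) ^ (n + 1) * g n) D := by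
    simpa only [hg, mul_sub, hD, sub_div] using (hasSum_S' hκ hξ hx).sub (hasSum_S' hκ hη hx)
  have htail : |D - (κ / 2 * g 0 + (κ / 2) ^ 2 * g 1)| ≤ 2 * (κ / 2) ^ 3 / (1 - κ / 2) :=
    abs_sub_le_of_hasSum_pow_succ_mul (by linarith) (by linarith) (fun n => (abs_sub _ _).trans
      ((add_le_add (abs_cos_le_one _) (abs_cos_le_one _)).trans_eq one_add_one_eq_two)) hsum
  have hg0 : κ / 2 * g 0 = -(κ * cos (π * x)) := by
    simp only [hg, zero_add, two_pi_mul_invBranch_one, h, Fin.val_one, Fin.val_zero,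
      Nat.cast_one, Nat.cast_zero, one_mul, zero_mul, add_zero, cos_add_pi]
    ring
  have hg1 : |(κ / 2) ^ 2 * g 1| ≤ (κ / 2) ^ 2 * √2 := by
    rw [abs_mul, abs_of_nonneg (sq_nonneg (κ / 2))]
    exact mul_le_mul_of_nonneg_left (abs_cos_invBranch_two_sub_le x h) (sq_nonneg _)
  have htriangle : |κ / 2 * g 0| ≤
      |D| + |D - (κ / 2 * g 0 + (κ / 2) ^ 2 * g 1)| + |(κ / 2) ^ 2 * g 1| :=
    calc |κ / 2 * g 0|
        = |D - (D - (κ / 2 * g 0 + (κ / 2) ^ 2 * g 1)) - (κ / 2) ^ 2 * g 1| := by congr 1; ring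
      _ ≤ _ := (abs_sub _ _).trans (by gcongr; exact abs_sub _ _)
  have hlower : κ * (|cos (π * x)| - cosBound κ) ≤ |D| :=
    calc κ * (|cos (π * x)| - cosBound κ)
        = |κ / 2 * g 0| - 2 * (κ / 2) ^ 3 / (1 - κ / 2) - (κ / 2) ^ 2 * √2 := by
          have : 2 - κ ≠ 0 := by linarith
          have : 1 - κ / 2 ≠ 0 := by linarith
          rw [hg0, abs_neg, abs_mul, abs_of_pos h0, cosBound]
          field_simp
          ring
      _ ≤ |D| := by linarith
  rw [hD, abs_div, abs_of_pos (by positivity : 0 < (2 * π) ^ 2), le_div_iff₀ (by positivity)]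
    at hlower
  linarith

theorem mul_add_mul_le_sqrt {p q : ℝ} (h : p ^ 2 + q ^ 2 = 1) (a b : ℝ) :
    p * a + q * b ≤ √(a ^ 2 + b ^ 2) :=
  le_sqrt_of_sq_le <| by
    calc (p * a + q * b) ^ 2 = (p ^ 2 + q ^ 2) * (a ^ 2 + b ^ 2) - (p * b - q * a) ^ 2 := by ring
      _ ≤ a ^ 2 + b ^ 2 := by rw [h, one_mul]; exact sub_le_self _ (sq_nonneg _)

theorem norm_V (κ ξ η x : ℝ) :
    ‖V κ ξ η x‖ = √(|S κ ξ x - S κ η x| ^ 2 + |S' κ ξ x - S' κ η x| ^ 2) := by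
  simp [V, EuclideanSpace.norm_eq]

theorem norm_V_comm (κ ξ η x : ℝ) : ‖V κ ξ η x‖ = ‖V κ η ξ x‖ := by
  rw [norm_V, norm_V, abs_sub_comm (S κ ξ x), abs_sub_comm (S' κ ξ x)]

theorem le_norm_V (h0 : 0 < κ) (h1 : κ < 1) (hξ : ξ ∈ Icc (0 : ℝ) 1) (hη : η ∈ Icc (0 : ℝ) 1)
    (hx : x ∈ Icc (0 : ℝ) 1) (h : LeadingDigitsLT η ξ) :
    normBound κ ≤ ‖V κ ξ η x‖ := by
  set s := sin (π * x)
  set c := |cos (π * x)|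
  have hunit : s ^ 2 + c ^ 2 = 1 := by rw [sq_abs, sin_sq_add_cos_sq]
  have hs : 0 ≤ s := sin_nonneg_of_nonneg_of_le_pi (mul_nonneg pi_pos.le hx.1)
    (mul_le_of_le_one_right pi_pos.le hx.2)
  have hS : 4 * π * κ * (s - sinBound κ) ≤ |S κ ξ x - S κ η x| :=
    sin_sub_sinBound_le h0 h1 hξ hη hx h
  have hS' : 4 * π * κ * (c - cosBound κ) ≤ |S' κ ξ x - S' κ η x| := by
    have := abs_cos_sub_cosBound_le h0 h1 hξ hη hx h.digit_zero_eq
    rcases le_total 0 (4 * π * κ * (c - cosBound κ)) with hnonneg | hnonpos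
    · nlinarith [pi_gt_three]
    · exact hnonpos.trans (abs_nonneg _)
  calc normBound κ
      ≤ 4 * π * κ * (1 - (s * sinBound κ + c * cosBound κ)) := by
        unfold normBound
        gcongr
        exact mul_add_mul_le_sqrt hunit _ _
    _ = s * (4 * π * κ * (s - sinBound κ)) + c * (4 * π * κ * (c - cosBound κ)) := by
        rw [← hunit]; ring
    _ ≤ s * |S κ ξ x - S κ η x| + c * |S' κ ξ x - S' κ η x| := by gcongr
    _ ≤ ‖V κ ξ η x‖ := by rw [norm_V]; exact mul_add_mul_le_sqrt hunit _ _

end LowerBounds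

theorem sinBound_sq_add_cosBound_sq_lt_one {κ : ℝ} (h0 : 0 < κ) (hκ : κ ≤ 0.55) :
    sinBound κ ^ 2 + cosBound κ ^ 2 < 1 := by
  norm_num at hκ
  have h1 : 0 < 1 - κ := by linarith
  have h2 : 0 < 2 - κ := by linarith
  have hsqrt : √2 ≤ 1.415 := by
    rw [sqrt_le_left (by norm_num)]
    norm_num
  have hsin : sinBound κ ≤ 0.95 :=
    calc sinBound κ ≤ 0.55 / 2 + 0.55 ^ 2 / (1 - 0.55) := by
          unfold sinBound; gcongr <;> norm_num <;> linarith
      _ ≤ 0.95 := by norm_num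
  have hcos : cosBound κ ≤ 0.3 :=
    calc cosBound κ ≤ 1.415 * 0.55 / 4 + 0.55 ^ 2 / (2 * (2 - 0.55)) := by
          unfold cosBound; gcongr <;> norm_num <;> linarith
      _ ≤ 0.3 := by norm_num
  have hsin0 : 0 ≤ sinBound κ := by unfold sinBound; positivity
  have hcos0 : 0 ≤ cosBound κ := by unfold cosBound; positivity
  calc sinBound κ ^ 2 + cosBound κ ^ 2 ≤ 0.95 ^ 2 + 0.3 ^ 2 := by gcongr
    _ < 1 := by norm_num

theorem normBound_pos {κ : ℝ} (h0 : 0 < κ) (hκ : κ ≤ 0.55) : 0 < normBound κ := by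
  refine mul_pos (by positivity) (sub_pos.2 ?_)
  rw [sqrt_lt' one_pos, one_pow]
  exact sinBound_sq_add_cosBound_sq_lt_one h0 hκ

end Weierstrass

theorem proposition4p1_general {κ : ℝ} (h0 : 0 < κ) (h1 : κ < 1) :
    (∀ ξ ∈ Icc (0 : ℝ) 1, DifferentiableOn ℝ (Weierstrass.S κ ξ) (Icc 0 1)) ∧
      ∀ ξ ∈ Icc (0 : ℝ) 1, ∀ η ∈ Icc (0 : ℝ) 1,
        Weierstrass.LeadingDigitsLT η ξ ∨ Weierstrass.LeadingDigitsLT ξ η →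
          Weierstrass.normBound κ ≤ ⨅ x : Icc (0 : ℝ) 1, ‖Weierstrass.V κ ξ η (x : ℝ)‖ := by
  have hκ : |κ| < 1 := by rwa [abs_of_pos h0]
  refine ⟨fun ξ hξ x hx => (Weierstrass.hasDerivWithinAt_S hκ hξ hx).differentiableWithinAt,
    fun ξ hξ η hη h => le_ciInf fun x => ?_⟩
  rcases h with h | h
  · exact Weierstrass.le_norm_V h0 h1 hξ hη x.2 h
  · exact (Weierstrass.le_norm_V h0 h1 hη hξ x.2 h).trans_eq (Weierstrass.norm_V_comm κ η ξ x)

theorem proposition4p1 :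
    ∃ κ₀ ∈ Set.Icc (0.55 : ℝ) 0.56, ∀ κ : ℝ, 0 < κ → κ ≤ κ₀ →
      (∀ ξ ∈ Set.Icc (0 : ℝ) 1, DifferentiableOn ℝ (Weierstrass.S κ ξ) (Set.Icc 0 1)) ∧
      ∃ c : ℝ, 0 < c ∧ ∀ ξ ∈ Set.Icc (0 : ℝ) 1, ∀ η ∈ Set.Icc (0 : ℝ) 1, (1 / 2 : ℝ) < |ξ - η| →
        c ≤ ⨅ x : Set.Icc (0 : ℝ) 1, ‖Weierstrass.V κ ξ η (x : ℝ)‖ := by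
  refine ⟨0.55, by norm_num, fun κ h0 hκ => ?_⟩
  have hbound := Weierstrass.normBound_pos h0 hκ
  exact (proposition4p1_general h0 (by norm_num at hκ; linarith)).imp_right fun h =>
    ⟨_, hbound, fun ξ hξ η hη hdist =>
      h ξ hξ η hη (Weierstrass.leadingDigitsLT_or_leadingDigitsLT hξ hη hdist)⟩
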